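/- A quasi-norm on a vector space $X$ over $\mathbb{F}\in\{\mathbb{R},\mathbb{C}\}$ is a map $\|\cdot\|\colon X\to[0,\infty)$ that vanishes only at $0$, is absolutely homogeneous, and satisfies $\|f+g\|\le\kappa(\|f\|+\|g\|)$ for some constant $\kappa\ge 1$; $X$ is a quasi-Banach space if it is complete for the induced vector topology. A countable family $\mathcal{B}=(x_\nu)_{\nu\in N}$ in $X$ is an unconditional basis of $X$ if every $f\in X$ has a unique expansion $f=\sum_{\nu} a_\nu x_\nu$ converging unconditionally; the support of $f$ is $\{\nu: a_\nu\ne 0\}$. For $0<q\le\infty$, $\mathcal{B}$ satisfies an upper (resp. lower) $q$-estimate if there is $C>0$ such that $$\Big\|\sum_{i=1}^m f_i\Big\|\le C\Big(\sum_{i=1}^m\|f_i\|^q\Big)^{1/q}\qquad\Big(\text{resp. } \Big(\sum_{i=1}^m\|f_i\|^q\Big)^{1/q}\le C\Big\|\sum_{i=1}^m f_i\Big\|\Big)$$ for all $m\in\mathbb{N}$ and all $f_1,\dots,f_m\in X$ with pairwise disjoint supports (with the maximum of the $\|f_i\|$ in place of the $\ell_q$-sum if $q=\infty$). Two quasi-Banach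 spaces are totally incomparable if no infinite-dimensional quasi-Banach space is isomorphic both to a subspace of the first and to a subspace of the second. Let $n\in\mathbb{N}$ and let $X_1,\dots,X_n$ be quasi-Banach spaces over $\mathbb{F}$, each $X_j$ having an unconditional basis $\mathcal{B}_j$. Suppose that there are $(q_j)_{j=1}^{n-1}$ and $(r_j)_{j=2}^{n}$ in $(0,\infty]$ such that - $q_j<r_{j+1}$ for all $1\le j\le n-1$; - $\mathcal{B}_j$ satisfies a lower $q_j$-estimate for all $1\le j\le n-1$; - $\mathcal{B}_j$ satisfies an upper $r_j$-estimate for all $2\le j\le n$; - for each $2\le j\le n-1$, $X_j$ is infinite-dimensional or $r_j\le q_j$. Then for every partition $(A,B)$ of $\{1,\dots,n\}$ (one of the parts may be empty), the spaces $\bigoplus_{j\in A}X_j$ and $\bigoplus_{j\in B}X_j$ are totally incomparable. -/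

import Mathlib

open scoped ENNReal Uniformity

universe u v w

/-- `X`, with the given `‖·‖`, is a quasi-Banach space over `𝕜` (`ℝ` or `ℂ`): `‖·‖` is a quasi-norm,
the uniform structure (hence the topology) of `X` is the one given by the sets
`{(f, g) | ‖f - g‖ < ε}`, and `X` is complete. -/
class QuasiBanachSpace (𝕜 : Type*) [RCLike 𝕜] (X : Type*) [AddCommGroup X] [Module 𝕜 X]
    [Norm X] [UniformSpace X] : Prop extends CompleteSpace X where
  norm_nonneg : ∀ f : X, 0 ≤ ‖f‖
  norm_eq_zero_iff : ∀ f : X, ‖f‖ = 0 ↔ f = 0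
  norm_smul : ∀ (a : 𝕜) (f : X), ‖a • f‖ = ‖a‖ * ‖f‖
  exists_norm_add_le : ∃ κ : ℝ, 1 ≤ κ ∧ ∀ f g : X, ‖f + g‖ ≤ κ * (‖f‖ + ‖g‖)
  uniformity_hasBasis :
    (𝓤 X).HasBasis (fun ε : ℝ => 0 < ε) (fun ε => {p : X × X | ‖p.1 - p.2‖ < ε})

/-- The countable family `x` is an unconditional basis of `X`: every vector has a unique expansion
that converges unconditionally. (Then the closed linear span of the family is all of `X`. `HasSum`
is convergence along the net of finite subsets of the index set, i.e. unconditional convergence.) -/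
structure IsUnconditionalBasis (𝕜 : Type*) [RCLike 𝕜] {X : Type*} [AddCommGroup X] [Module 𝕜 X]
    [TopologicalSpace X] {ι : Type*} (x : ι → X) : Prop where
  countable : Countable ι
  existsUnique_hasSum : ∀ f : X, ∃! a : ι → 𝕜, HasSum (fun n => a n • x n) f

/-- The `ℓ_q` quasi-norm, `0 < q ≤ ∞`, of a finite family of nonnegative real numbers. -/
noncomputable def lqSum (q : ℝ≥0∞) {m : ℕ} (c : Fin m → ℝ) : ℝ :=
  if q = ∞ then ⨆ j, c j else (∑ j, c j ^ q.toReal) ^ (1 / q.toReal)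

namespace IsUnconditionalBasis

variable {𝕜 : Type*} [RCLike 𝕜] {X : Type*} [AddCommGroup X] [Module 𝕜 X] [TopologicalSpace X]
  {ι : Type*} {x : ι → X}

/-- The coefficients of `f` with respect to the basis. -/
noncomputable def coeff (hx : IsUnconditionalBasis 𝕜 x) (f : X) : ι → 𝕜 :=
  (hx.existsUnique_hasSum f).choose

/-- The support of `f` with respect to the basis. -/
def supp (hx : IsUnconditionalBasis 𝕜 x) (f : X) : Set ι :=
  {n | hx.coeff f n ≠ 0}

/-- The basis satisfies an upper `q`-estimate. -/
def UpperEstimate [Norm X] (hx : IsUnconditionalBasis 𝕜 x) (q : ℝ≥0∞) : Prop :=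
  ∃ C : ℝ, 0 < C ∧ ∀ (m : ℕ) (f : Fin m → X),
    (Pairwise fun i j => Disjoint (hx.supp (f i)) (hx.supp (f j))) →
      ‖∑ j, f j‖ ≤ C * lqSum q fun j => ‖f j‖

/-- The basis satisfies a lower `q`-estimate. -/
def LowerEstimate [Norm X] (hx : IsUnconditionalBasis 𝕜 x) (q : ℝ≥0∞) : Prop :=
  ∃ C : ℝ, 0 < C ∧ ∀ (m : ℕ) (f : Fin m → X),
    (Pairwise fun i j => Disjoint (hx.supp (f i)) (hx.supp (f j))) →
      lqSum q (fun j => ‖f j‖) ≤ C * ‖∑ j, f j‖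

end IsUnconditionalBasis

/-- `X` and `Y` are totally incomparable: no infinite-dimensional quasi-Banach space `Z` is
isomorphic both to a subspace of `X` and to a subspace of `Y`. Only the linear and topological
structures of `X` and `Y` matter. -/
def TotallyIncomparable (𝕜 : Type*) [RCLike 𝕜]
    (X : Type*) [AddCommGroup X] [Module 𝕜 X] [TopologicalSpace X]
    (Y : Type*) [AddCommGroup Y] [Module 𝕜 Y] [TopologicalSpace Y] : Prop :=
  ¬ ∃ (Z : Type w) (_ : AddCommGroup Z) (_ : Module 𝕜 Z) (_ : Norm Z) (_ : UniformSpace Z),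
    QuasiBanachSpace 𝕜 Z ∧ ¬ FiniteDimensional 𝕜 Z ∧
      (∃ M : Submodule 𝕜 X, Nonempty (Z ≃L[𝕜] M)) ∧
      (∃ N : Submodule 𝕜 Y, Nonempty (Z ≃L[𝕜] N))

/-! Suppose an infinite-dimensional `Z` embeds in both sums, with components `T j`. The components
in `A` alone control the norm of `Z`, and so do those in `B`. Let `i` be the first index at which
the components up to and including `i` can no longer all be made small on normalized vectors of
every coordinate subspace of finite codimension (`exists_critical_index`); say `i ∈ A`. A gliding
hump (`exists_gliding_hump`) yields normalized `z k` whose images are almost disjointly supported,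
with `T i (z k)` bounded below and `T j (z k)` tiny for `j < i`. Let `S m` be their partial sums.
The lower estimate of `X i` forces `‖S m‖ ≳ m ^ (1 / q i)`. For `j ∈ B`, `T j (S m)` stays bounded
if `j < i` and is `O(m ^ (1 / r j))` if `j > i`; as `q i < r j`, this is `o(m ^ (1 / q i))`,
contradicting that `B` controls the norm. Only consecutive `q i < r (i + 1)` are assumed;
`le_of_lowerEstimate_of_upperEstimate` links them into a chain. -/

/-! ### Quasi-norms: topology and finite sums -/

namespace QuasiBanachSpace

variable (𝕜 : Type*) [RCLike 𝕜] {X : Type*} [AddCommGroup X] [Module 𝕜 X]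
  [Norm X] [UniformSpace X] [QuasiBanachSpace 𝕜 X]

include 𝕜

theorem norm_neg (f : X) : ‖-f‖ = ‖f‖ := by
  have h := norm_smul (-1 : 𝕜) f
  simpa using h

theorem norm_zero : ‖(0 : X)‖ = 0 := (norm_eq_zero_iff 𝕜 0).2 rfl

theorem norm_pos {f : X} (hf : f ≠ 0) : 0 < ‖f‖ :=
  lt_of_le_of_ne (norm_nonneg 𝕜 f) fun h => hf ((norm_eq_zero_iff 𝕜 f).1 h.symm)

theorem norm_sub_comm (f g : X) : ‖f - g‖ = ‖g - f‖ := by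
  rw [← norm_neg 𝕜 (f - g), neg_sub]

theorem nhds_hasBasis (f : X) :
    (nhds f).HasBasis (fun ε : ℝ => 0 < ε) (fun ε => {g | ‖g - f‖ < ε}) := by
  have h := nhds_basis_uniformity (uniformity_hasBasis (𝕜 := 𝕜) (X := X)) (x := f)
  simpa using h

theorem continuousAdd : ContinuousAdd X := by
  obtain ⟨κ, hκ, hadd⟩ := exists_norm_add_le 𝕜 (X := X)
  refine ⟨continuous_iff_continuousAt.2 fun p => ?_⟩
  obtain ⟨a, b⟩ := p
  rw [ContinuousAt, nhds_prod_eq,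
    ((nhds_hasBasis 𝕜 a).prod (nhds_hasBasis 𝕜 b)).tendsto_iff (nhds_hasBasis 𝕜 _)]
  intro ε hε
  refine ⟨(ε / (2 * κ), ε / (2 * κ)), ⟨by positivity, by positivity⟩, ?_⟩
  rintro ⟨f, g⟩ ⟨hf, hg⟩
  simp only [Set.mem_ofPred_eq] at hf hg ⊢
  rw [add_sub_add_comm]
  have hκ0 : 0 < κ := by linarith
  calc ‖f - a + (g - b)‖ ≤ κ * (‖f - a‖ + ‖g - b‖) := hadd _ _
    _ < κ * (ε / (2 * κ) + ε / (2 * κ)) := by gcongr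
    _ = ε := by field_simp; ring

theorem t2Space : T2Space X := by
  have : T0Space X := t0Space_iff_uniformity.2 fun f g h => by
    by_contra hne
    have := norm_pos 𝕜 (sub_ne_zero.2 hne)
    have := h _ (uniformity_hasBasis (𝕜 := 𝕜).mem_of_mem this)
    exact lt_irrefl ‖f - g‖ this
  infer_instance

theorem continuousConstSMul : ContinuousConstSMul 𝕜 X := by
  refine ⟨fun c => continuous_iff_continuousAt.2 fun a => ?_⟩
  rw [ContinuousAt, (nhds_hasBasis 𝕜 a).tendsto_iff (nhds_hasBasis 𝕜 _)]
  intro ε hε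
  refine ⟨ε / (‖c‖ + 1), by positivity, fun x hx => ?_⟩
  simp only [Set.mem_ofPred_eq] at hx ⊢
  rw [← smul_sub, norm_smul]
  rw [lt_div_iff₀ (by positivity)] at hx
  nlinarith [norm_nonneg 𝕜 (x - a)]

/-- The modulus of concavity in the form of a weighted triangle inequality for finite sums. -/
theorem norm_sum_le {κ : ℝ} (hκ : 1 ≤ κ) (hadd : ∀ f g : X, ‖f + g‖ ≤ κ * (‖f‖ + ‖g‖))
    (m : ℕ) (u : ℕ → X) :
    ‖∑ k ∈ Finset.range m, u k‖ ≤ ∑ k ∈ Finset.range m, κ ^ (k + 1) * ‖u k‖ := by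
  induction m generalizing u with
  | zero => simp [norm_zero 𝕜]
  | succ m ih =>
    rw [Finset.sum_range_succ', Finset.sum_range_succ']
    refine (hadd _ _).trans ?_
    have h := mul_le_mul_of_nonneg_left (ih fun k => u (k + 1)) (by linarith : (0 : ℝ) ≤ κ)
    rw [Finset.mul_sum] at h
    have e : ∑ k ∈ Finset.range m, κ * (κ ^ (k + 1) * ‖u (k + 1)‖)
        = ∑ k ∈ Finset.range m, κ ^ (k + 1 + 1) * ‖u (k + 1)‖ :=
      Finset.sum_congr rfl fun k _ => by ring
    rw [e] at h
    simp only [zero_add, pow_one]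
    linarith

/-- The factor `κ ^ (k + 1)` absorbs the weights of `norm_sum_le`, and the remaining `2 ^ (k + 1)`
makes the series sum to at most `ε`. Hence perturbation errors stay bounded independently of `m`. -/
theorem norm_sum_le_of_norm_le_geometric {κ : ℝ} (hκ : 1 ≤ κ)
    (hadd : ∀ f g : X, ‖f + g‖ ≤ κ * (‖f‖ + ‖g‖)) {ε : ℝ} (hε : 0 ≤ ε)
    (u : ℕ → X) (hu : ∀ k, ‖u k‖ ≤ ε / (2 * κ) ^ (k + 1)) (m : ℕ) :
    ‖∑ k ∈ Finset.range m, u k‖ ≤ ε := by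
  refine (norm_sum_le 𝕜 hκ hadd m u).trans ?_
  have hκ0 : 0 < κ := by linarith
  have h : ∀ k ∈ Finset.range m, κ ^ (k + 1) * ‖u k‖ ≤ ε / 2 * (1 / 2) ^ k := by
    intro k _
    refine (mul_le_mul_of_nonneg_left (hu k) (by positivity)).trans (le_of_eq ?_)
    rw [mul_pow]
    field_simp
    rw [one_div_pow]
    field_simp
    ring
  refine (Finset.sum_le_sum h).trans ?_
  rw [← Finset.mul_sum]
  have := sum_geometric_two_le m
  nlinarith

theorem exists_common_norm_add_le {J : Type*} [Finite J] (X : J → Type*)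
    [∀ j, AddCommGroup (X j)] [∀ j, Module 𝕜 (X j)] [∀ j, Norm (X j)] [∀ j, UniformSpace (X j)]
    [∀ j, QuasiBanachSpace 𝕜 (X j)] :
    ∃ κ : ℝ, 1 ≤ κ ∧ ∀ j, ∀ f g : X j, ‖f + g‖ ≤ κ * (‖f‖ + ‖g‖) := by
  choose κ hκ hadd using fun j => exists_norm_add_le 𝕜 (X := X j)
  obtain ⟨M, hM⟩ := (Set.finite_range κ).bddAbove
  refine ⟨max M 1, le_max_right _ _, fun j f g => (hadd j f g).trans ?_⟩
  have h : κ j ≤ max M 1 := (hM ⟨j, rfl⟩).trans (le_max_left _ _)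
  exact mul_le_mul_of_nonneg_right h (add_nonneg (norm_nonneg 𝕜 f) (norm_nonneg 𝕜 g))

end QuasiBanachSpace

/-! ### Bounded operators and embeddings into direct sums -/

namespace QuasiBanachSpace

variable {𝕜 : Type*} [RCLike 𝕜] {X : Type*} [AddCommGroup X] [Module 𝕜 X]
  [Norm X] [UniformSpace X] [QuasiBanachSpace 𝕜 X] {Y : Type*} [AddCommGroup Y] [Module 𝕜 Y] [Norm Y] [UniformSpace Y]
  [QuasiBanachSpace 𝕜 Y]

theorem exists_norm_map_le (T : X →L[𝕜] Y) : ∃ K : ℝ, 0 < K ∧ ∀ z, ‖T z‖ ≤ K * ‖z‖ := by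
  have h := T.continuous.tendsto 0
  rw [map_zero, (nhds_hasBasis 𝕜 0).tendsto_iff (nhds_hasBasis 𝕜 0)] at h
  obtain ⟨δ, hδ, hT⟩ := h 1 one_pos
  refine ⟨2 / δ, by positivity, fun z => ?_⟩
  by_cases hz : z = 0
  · simp [hz, norm_zero 𝕜]
  have hz' := norm_pos 𝕜 hz
  have hc : ‖((δ / (2 * ‖z‖) : ℝ) : 𝕜)‖ = δ / (2 * ‖z‖) := by
    rw [RCLike.norm_ofReal, abs_of_nonneg (by positivity)]
  have := hT (((δ / (2 * ‖z‖) : ℝ) : 𝕜) • z) (by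
    simp only [Set.mem_ofPred_eq, sub_zero]
    rw [norm_smul, hc]
    field_simp
    norm_num)
  simp only [Set.mem_ofPred_eq, sub_zero, map_smul] at this
  rw [norm_smul, hc, div_mul_eq_mul_div, div_lt_one (by positivity)] at this
  rw [div_mul_eq_mul_div, le_div_iff₀ hδ]
  linarith

/-- An isomorphism onto a subspace of a finite direct sum is bounded below by the maximum of its
components. -/
theorem exists_le_norm_component {J : Type*} [Finite J] {X : J → Type*}
    [∀ j, AddCommGroup (X j)] [∀ j, Module 𝕜 (X j)] [∀ j, Norm (X j)] [∀ j, UniformSpace (X j)]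
    [∀ j, QuasiBanachSpace 𝕜 (X j)] {M : Submodule 𝕜 ((j : J) → X j)} (e : Y ≃L[𝕜] M) :
    ∃ c : ℝ, 0 < c ∧ ∀ z : Y, z ≠ 0 → ∃ j, c * ‖z‖ ≤ ‖(e z : (j : J) → X j) j‖ := by
  have h := e.symm.continuous.tendsto 0
  rw [map_zero, (nhds_hasBasis 𝕜 0).tendsto_right_iff] at h
  have h1 := h 1 one_pos
  rw [nhds_subtype_eq_comap, Filter.eventually_comap] at h1
  -- The product carries only a topology, so continuity of `e.symm` at `0` is turned into a box with
  -- one radius for all components.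
  have h2 : ∃ δ : ℝ, 0 < δ ∧ ∀ v : (j : J) → X j, (∀ j, ‖v j‖ < δ) →
      ∀ a : M, (a : (j : J) → X j) = v → ‖e.symm a‖ < 1 := by
    rw [nhds_pi, Filter.eventually_iff,
      (Filter.hasBasis_pi fun j => nhds_hasBasis 𝕜 _).mem_iff] at h1
    obtain ⟨⟨I, δ⟩, ⟨hI, hδ⟩, hsub⟩ := h1
    simp only at hI hδ hsub
    have : ∃ d : ℝ, 0 < d ∧ ∀ j ∈ I, d ≤ δ j := by
      have := hI.induction_on (motive := fun I _ => (∀ i ∈ I, 0 < δ i) →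
        ∃ d : ℝ, 0 < d ∧ ∀ j ∈ I, d ≤ δ j)
      refine this ?_ ?_ hδ
      · exact fun _ => ⟨1, one_pos, by simp⟩
      · intro a s _ _ ih hs
        obtain ⟨d, hd, hd'⟩ := ih fun i hi => hs i (Set.mem_insert_of_mem _ hi)
        refine ⟨min d (δ a), lt_min hd (hs a (Set.mem_insert _ _)), ?_⟩
        rintro j (rfl | hj)
        · exact min_le_right _ _
        · exact (min_le_left _ _).trans (hd' j hj)
    obtain ⟨d, hd, hd'⟩ := this
    refine ⟨d, hd, fun v hv a ha => ?_⟩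
    have hmem : v ∈ I.pi fun i => {g : X i | ‖g - ((0 : M) : (j : J) → X j) i‖ < δ i} := by
      intro j hj
      simpa using (hv j).trans_le (hd' j hj)
    simpa using hsub hmem a ha
  obtain ⟨δ, hδ, hv⟩ := h2
  refine ⟨δ / 2, by positivity, fun z hz => ?_⟩
  by_contra! hcon
  have hz' := norm_pos 𝕜 hz
  have hc : ‖((1 / ‖z‖ : ℝ) : 𝕜)‖ = 1 / ‖z‖ := by
    rw [RCLike.norm_ofReal, abs_of_nonneg (by positivity)]
  have := hv _ (fun j => ?_) (e (((1 / ‖z‖ : ℝ) : 𝕜) • z)) rfl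
  · rw [e.symm_apply_apply, norm_smul, hc] at this
    field_simp at this
    exact lt_irrefl _ this
  · rw [map_smul]
    simp only [Submodule.coe_smul, Pi.smul_apply]
    rw [norm_smul, hc, one_div, inv_mul_lt_iff₀ hz']
    have := hcon j
    nlinarith

end QuasiBanachSpace

/-! ### Growth of `ℓ_q` sums -/

section lqSum

theorem mul_rpow_le_lqSum {q : ℝ≥0∞} (hq : 0 < q) (hq' : q ≠ ∞) {m : ℕ} {a : Fin m → ℝ} {c : ℝ}
    (hc : 0 ≤ c) (ha : ∀ j, c ≤ a j) : c * (m : ℝ) ^ (1 / q.toReal) ≤ lqSum q a := by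
  have hq0 : 0 < q.toReal := ENNReal.toReal_pos hq.ne' hq'
  rw [lqSum, if_neg hq']
  calc c * (m : ℝ) ^ (1 / q.toReal) = ((m : ℝ) * c ^ q.toReal) ^ (1 / q.toReal) := by
        rw [Real.mul_rpow (by positivity) (by positivity), ← Real.rpow_mul hc,
          mul_one_div_cancel hq0.ne', Real.rpow_one, mul_comm]
    _ ≤ _ := by
        refine Real.rpow_le_rpow (by positivity) ?_ (by positivity)
        have : (m : ℝ) * c ^ q.toReal = ∑ _j : Fin m, c ^ q.toReal := by simp
        rw [this]
        exact Finset.sum_le_sum fun j _ => Real.rpow_le_rpow hc (ha j) hq0.le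

/-- The case `q = ∞` is included: `∞.toReal = 0` and `1 / 0 = 0`, so the power of `m` is `1`. -/
theorem lqSum_le_mul_rpow {q : ℝ≥0∞} (hq : 0 < q) {m : ℕ} {a : Fin m → ℝ} {D : ℝ}
    (hD : 0 ≤ D) (ha : ∀ j, 0 ≤ a j) (haD : ∀ j, a j ≤ D) :
    lqSum q a ≤ D * (m : ℝ) ^ (1 / q.toReal) := by
  rw [lqSum]
  split_ifs with hq'
  · simp only [hq', ENNReal.toReal_top, div_zero, Real.rpow_zero, mul_one]
    exact Real.iSup_le haD hD
  · have hq0 : 0 < q.toReal := ENNReal.toReal_pos hq.ne' hq'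
    calc (∑ j, a j ^ q.toReal) ^ (1 / q.toReal)
        ≤ ((m : ℝ) * D ^ q.toReal) ^ (1 / q.toReal) := by
          refine Real.rpow_le_rpow
            (Finset.sum_nonneg fun j _ => Real.rpow_nonneg (ha j) _) ?_ (by positivity)
          have : (m : ℝ) * D ^ q.toReal = ∑ _j : Fin m, D ^ q.toReal := by simp
          rw [this]
          exact Finset.sum_le_sum fun j _ => Real.rpow_le_rpow (ha j) (haD j) hq0.le
      _ = _ := by
        rw [Real.mul_rpow (by positivity) (by positivity), ← Real.rpow_mul hD,
          mul_one_div_cancel hq0.ne', Real.rpow_one, mul_comm]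

theorem one_div_toReal_lt {q r : ℝ≥0∞} (hq : 0 < q) (hqr : q < r) :
    1 / r.toReal < 1 / q.toReal := by
  have hq0 : 0 < q.toReal := ENNReal.toReal_pos hq.ne' hqr.ne_top
  by_cases hr : r = ∞
  · simpa [hr] using hq0
  · exact one_div_lt_one_div_of_lt hq0 ((ENNReal.toReal_lt_toReal hqr.ne_top hr).2 hqr)

/-- Lower powers are eventually dominated, also after adding constants. -/
theorem eventually_affine_rpow_le {s t : ℝ} (ht : 0 < t) (hst : s < t) (a b : ℝ) {δ : ℝ}
    (hδ : 0 < δ) :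
    ∀ᶠ m : ℕ in Filter.atTop, a * (m : ℝ) ^ s + b ≤ δ * (m : ℝ) ^ t := by
  have h1 : Filter.Tendsto (fun y : ℝ => a * y ^ (-(t - s)) + b * y ^ (-t)) Filter.atTop
      (nhds (a * 0 + b * 0)) :=
    ((tendsto_rpow_neg_atTop (sub_pos.2 hst)).const_mul a).add
      ((tendsto_rpow_neg_atTop ht).const_mul b)
  rw [mul_zero, mul_zero, add_zero] at h1
  have h2 := h1.comp (tendsto_natCast_atTop_atTop (R := ℝ))
  filter_upwards [h2.eventually_le_const hδ, Filter.eventually_gt_atTop 0] with m hm hm0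
  have hm0' : (0 : ℝ) < m := by exact_mod_cast hm0
  have hpos : 0 < (m : ℝ) ^ t := by positivity
  have h3 : a * (m : ℝ) ^ s + b
      = (a * (m : ℝ) ^ (-(t - s)) + b * (m : ℝ) ^ (-t)) * (m : ℝ) ^ t := by
    rw [add_mul, mul_assoc, mul_assoc, ← Real.rpow_add hm0', ← Real.rpow_add hm0']
    simp
  rw [h3]
  exact mul_le_mul_of_nonneg_right hm hpos.le

end lqSum

/-! ### Coefficients and supports for unconditional bases -/

namespace IsUnconditionalBasis

variable {𝕜 : Type*} [RCLike 𝕜] {X : Type*} [AddCommGroup X] [Module 𝕜 X]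

section

variable [TopologicalSpace X] {ι : Type*} {x : ι → X} (hx : IsUnconditionalBasis 𝕜 x)

include hx

theorem hasSum_coeff (f : X) : HasSum (fun ν => hx.coeff f ν • x ν) f :=
  (hx.existsUnique_hasSum f).choose_spec.1

theorem coeff_eq {f : X} {a : ι → 𝕜} (h : HasSum (fun ν => a ν • x ν) f) : hx.coeff f = a :=
  (hx.existsUnique_hasSum f).unique (hx.hasSum_coeff f) h

theorem coeff_add [ContinuousAdd X] (f g : X) : hx.coeff (f + g) = hx.coeff f + hx.coeff g :=
  hx.coeff_eq <| by
    simpa [add_smul] using (hx.hasSum_coeff f).add (hx.hasSum_coeff g)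

theorem coeff_smul [ContinuousConstSMul 𝕜 X] (c : 𝕜) (f : X) :
    hx.coeff (c • f) = c • hx.coeff f :=
  hx.coeff_eq <| by
    simpa [smul_smul] using (hx.hasSum_coeff f).const_smul c

theorem coeff_sum (a : ι → 𝕜) (s : Finset ι) :
    hx.coeff (∑ ν ∈ s, a ν • x ν) = Set.indicator (s : Set ι) a := by
  classical
  refine hx.coeff_eq ?_
  have h : ∑ ν ∈ s, a ν • x ν = ∑ ν ∈ s, Set.indicator (s : Set ι) a ν • x ν :=
    Finset.sum_congr rfl fun ν hν => by rw [Set.indicator_of_mem (by exact hν)]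
  rw [h]
  exact hasSum_sum_of_ne_finset_zero fun ν hν => by
    rw [Set.indicator_of_notMem (by exact_mod_cast hν), zero_smul]

theorem supp_smul_basis_subset (c : 𝕜) (ν : ι) : hx.supp (c • x ν) ⊆ {ν} := by
  intro μ hμ
  have h := hx.coeff_sum (fun _ => c) {ν}
  simp only [Finset.sum_singleton, Finset.coe_singleton] at h
  rw [supp, Set.mem_ofPred_eq, h] at hμ
  exact Set.mem_of_indicator_ne_zero hμ

theorem basis_ne_zero (ν : ι) : x ν ≠ 0 := by
  intro h
  have h1 := hx.coeff_sum (fun _ => 1) {ν}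
  have h2 := hx.coeff_sum (fun _ => 0) {ν}
  simp only [Finset.sum_singleton, Finset.coe_singleton, h, smul_zero] at h1 h2
  have := congrFun (h1.symm.trans h2) ν
  simp at this

end

variable [Norm X] [UniformSpace X] [QuasiBanachSpace 𝕜 X] {ι : Type*} {x : ι → X}
  (hx : IsUnconditionalBasis 𝕜 x)

include hx in
theorem infinite_index (hX : ¬ FiniteDimensional 𝕜 X) : Infinite ι := by
  by_contra hι
  rw [not_infinite_iff_finite] at hι
  have := Fintype.ofFinite ι
  have := QuasiBanachSpace.t2Space 𝕜 (X := X)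
  refine hX (Module.Finite.of_surjective (Fintype.linearCombination 𝕜 x) fun f =>
    ⟨hx.coeff f, ?_⟩)
  rw [Fintype.linearCombination_apply]
  exact (hasSum_fintype _).unique (hx.hasSum_coeff f)

/-- Every vector is approximated by a finitely supported one with smaller support. -/
theorem exists_finite_approx (f : X) {ε : ℝ} (hε : 0 < ε) :
    ∃ (g : X) (s : Finset ι), ‖f - g‖ < ε ∧ hx.supp g ⊆ s ∧ hx.supp g ⊆ hx.supp f := by
  have h := (hx.hasSum_coeff f).eventually
    ((QuasiBanachSpace.nhds_hasBasis 𝕜 f).mem_of_mem hε)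
  obtain ⟨s, hs⟩ := h.exists
  have hg := hx.coeff_sum (hx.coeff f) s
  refine ⟨∑ ν ∈ s, hx.coeff f ν • x ν, s, ?_, ?_, ?_⟩
  · rw [QuasiBanachSpace.norm_sub_comm 𝕜]
    exact hs
  · intro ν hν
    rw [supp, Set.mem_ofPred_eq, hg] at hν
    exact Set.mem_of_indicator_ne_zero hν
  · intro ν hν
    rw [supp, Set.mem_ofPred_eq, hg] at hν
    have := Set.mem_of_indicator_ne_zero hν
    rwa [Set.indicator_of_mem this] at hν

/-- Sums of `m` normalized basis vectors, available for every `m` in infinite dimension, give `m ^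
(1 / q) ≤ C * D * m ^ (1 / r)`, which fails for large `m` if `q < r`. -/
theorem le_of_lowerEstimate_of_upperEstimate (hX : ¬ FiniteDimensional 𝕜 X) {q r : ℝ≥0∞}
    (hq : 0 < q) (hl : hx.LowerEstimate q) (hu : hx.UpperEstimate r) : r ≤ q := by
  by_contra! hqr
  have := hx.infinite_index hX
  obtain ⟨C, hC, hl⟩ := hl
  obtain ⟨D, hD, hu⟩ := hu
  have hq0 : 0 < q.toReal := ENNReal.toReal_pos hq.ne' hqr.ne_top
  let e := Infinite.natEmbedding ι
  let f : ℕ → X := fun k => ((‖x (e k)‖⁻¹ : ℝ) : 𝕜) • x (e k)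
  have hf : ∀ k, ‖f k‖ = 1 := fun k => by
    have := QuasiBanachSpace.norm_pos 𝕜 (hx.basis_ne_zero (e k))
    simp only [f]
    rw [QuasiBanachSpace.norm_smul, RCLike.norm_ofReal, abs_of_nonneg (by positivity),
      inv_mul_cancel₀ this.ne']
  have hdis : ∀ m : ℕ, Pairwise fun i j : Fin m => Disjoint (hx.supp (f i)) (hx.supp (f j)) := by
    intro m i j hij
    refine Set.disjoint_of_subset (hx.supp_smul_basis_subset _ _) (hx.supp_smul_basis_subset _ _)
      (Set.disjoint_singleton.2 fun h => hij (Fin.ext (e.injective h)))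
  have key : ∀ m : ℕ, (m : ℝ) ^ (1 / q.toReal) ≤ C * D * (m : ℝ) ^ (1 / r.toReal) := fun m => by
    have h1 := hl m (fun k => f k) (hdis m)
    have h2 := hu m (fun k => f k) (hdis m)
    have h3 := mul_rpow_le_lqSum hq hqr.ne_top (a := fun k : Fin m => ‖f k‖) zero_le_one
      fun k => (hf k).ge
    have h4 := lqSum_le_mul_rpow (hq.trans hqr) (a := fun k : Fin m => ‖f k‖) zero_le_one
      (fun k => by rw [hf]; exact zero_le_one) fun k => (hf k).le
    rw [one_mul] at h3 h4
    calc _ ≤ _ := h3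
      _ ≤ _ := h1
      _ ≤ C * (D * (m : ℝ) ^ (1 / r.toReal)) := by gcongr; exact h2.trans (by gcongr)
      _ = _ := by ring
  obtain ⟨m, hm, hm0⟩ := ((eventually_affine_rpow_le (by positivity) (one_div_toReal_lt hq hqr)
    (C * D) 0 (one_half_pos (α := ℝ))).and (Filter.eventually_gt_atTop 0)).exists
  have hpos : 0 < (m : ℝ) ^ (1 / q.toReal) := by positivity
  linarith [key m]

end IsUnconditionalBasis

/-! ### Gliding hump, critical index and the contradiction -/

section Embeddings

open QuasiBanachSpace

variable {𝕜 : Type*} [RCLike 𝕜] {n : ℕ} {X : Fin n → Type*}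
  [∀ j, AddCommGroup (X j)] [∀ j, Module 𝕜 (X j)] [∀ j, Norm (X j)] [∀ j, UniformSpace (X j)]
  [∀ j, QuasiBanachSpace 𝕜 (X j)]
  {ι : Fin n → Type*} {x : (j : Fin n) → ι j → X j}
  {Z : Type*} [AddCommGroup Z] [Module 𝕜 Z] [UniformSpace Z]

/-- Gliding hump: if normalized vectors with property `P` exist in all coordinate subspaces of
finite codimension, then a sequence of them has images close to disjointly supported vectors. -/
theorem exists_gliding_hump (hx : ∀ j, IsUnconditionalBasis 𝕜 (x j)) (T : ∀ j, Z →L[𝕜] X j)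
    (ε : ℕ → ℝ) (hε : ∀ k, 0 < ε k) (P : ℕ → Z → Prop)
    (hP : ∀ k, ∀ F : Finset (Σ j, ι j), ∃ z : Z,
      (∀ p ∈ F, (hx p.1).coeff (T p.1 z) p.2 = 0) ∧ P k z) :
    ∃ (z : ℕ → Z) (y : ∀ j, ℕ → X j), (∀ k, P k (z k)) ∧
      (∀ j k, ‖T j (z k) - y j k‖ ≤ ε k) ∧
      ∀ j, Pairwise fun k l => Disjoint ((hx j).supp (y j k)) ((hx j).supp (y j l)) := by
  classical
  choose z hzF hzP using hP
  choose g s hg hgs hgf using fun k F j =>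
    (hx j).exists_finite_approx (T j (z k F)) (hε k)
  -- `F k` collects the supports of all approximants chosen before stage `k`; the next vector has
  -- zero coefficients there, and its approximants inherit this.
  let F : ℕ → Finset (Σ j, ι j) := fun k => Nat.rec ∅
    (fun k F => F ∪ Finset.univ.sigma fun j => s k F j) k
  have hFs : ∀ k, F (k + 1) = F k ∪ Finset.univ.sigma fun j => s k (F k) j := fun k => rfl
  have hmono : Monotone F := monotone_nat_of_le_succ fun k => by
    rw [hFs]; exact Finset.subset_union_left
  refine ⟨fun k => z k (F k), fun j k => g k (F k) j, fun k => hzP k (F k),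
    fun j k => (hg k (F k) j).le, fun j => ?_⟩
  have hlt : ∀ k l, k < l →
      Disjoint ((hx j).supp (g k (F k) j)) ((hx j).supp (g l (F l) j)) := by
    intro k l hkl
    refine Set.disjoint_left.2 fun ν hk hl => hgf l (F l) j hl ?_
    refine hzF l (F l) ⟨j, ν⟩ (hmono (Nat.succ_le_of_lt hkl) ?_)
    rw [Nat.succ_eq_add_one, hFs]
    exact Finset.mem_union_right _ (Finset.mem_sigma.2 ⟨Finset.mem_univ _, hgs k (F k) j hk⟩)
  intro k l hkl
  rcases lt_or_gt_of_ne hkl with h | h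
  · exact hlt k l h
  · exact (hlt l k h).symm

variable [Norm Z] [QuasiBanachSpace 𝕜 Z]

/-- An infinite-dimensional space contains a normalized vector whose images have finitely many
prescribed coefficients equal to zero. -/
theorem exists_norm_eq_one_coeff_eq_zero (hx : ∀ j, IsUnconditionalBasis 𝕜 (x j))
    (hZ : ¬ FiniteDimensional 𝕜 Z) (T : ∀ j, Z →L[𝕜] X j) (F : Finset (Σ j, ι j)) :
    ∃ z : Z, ‖z‖ = 1 ∧ ∀ p ∈ F, (hx p.1).coeff (T p.1 z) p.2 = 0 := by
  have hadd := fun j => continuousAdd 𝕜 (X := X j)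
  have hsmul := fun j => continuousConstSMul 𝕜 (X := X j)
  -- Linearity of the coefficient functionals suffices; their continuity is not needed.
  let φ : Z →ₗ[𝕜] (F → 𝕜) :=
    { toFun := fun z p => (hx p.1.1).coeff (T p.1.1 z) p.1.2
      map_add' := fun z w => by ext p; simp [IsUnconditionalBasis.coeff_add]
      map_smul' := fun c z => by ext p; simp [IsUnconditionalBasis.coeff_smul] }
  have hφ : ¬ Function.Injective φ := fun h => hZ (FiniteDimensional.of_injective φ h)
  rw [injective_iff_map_eq_zero] at hφ
  push Not at hφ
  obtain ⟨z, hz, hz0⟩ := hφ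
  have hz' := norm_pos 𝕜 hz0
  refine ⟨((‖z‖⁻¹ : ℝ) : 𝕜) • z, ?_, fun p hp => ?_⟩
  · rw [QuasiBanachSpace.norm_smul, RCLike.norm_ofReal, abs_of_nonneg (by positivity), inv_mul_cancel₀ hz'.ne']
  · have := congrFun hz ⟨p, hp⟩
    simp only [φ, LinearMap.coe_mk, AddHom.coe_mk, Pi.zero_apply] at this
    rw [map_smul, IsUnconditionalBasis.coeff_smul, Pi.smul_apply, this, smul_zero]

/-- There is an index `i` such that, on finite-codimensional coordinate subspaces, the components
below `i` can be made small simultaneously, while then the component `i` stays large. -/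
theorem exists_critical_index (hx : ∀ j, IsUnconditionalBasis 𝕜 (x j))
    (hZ : ¬ FiniteDimensional 𝕜 Z) (T : ∀ j, Z →L[𝕜] X j) {c : ℝ} (hc : 0 < c)
    (hT : ∀ z : Z, z ≠ 0 → ∃ j, c * ‖z‖ ≤ ‖T j z‖) :
    ∃ i : Fin n, ∃ ε₀ > 0, ∀ ε > 0, ∀ F : Finset (Σ j, ι j), ∃ z : Z, ‖z‖ = 1 ∧
      (∀ p ∈ F, (hx p.1).coeff (T p.1 z) p.2 = 0) ∧ (∀ j < i, ‖T j z‖ ≤ ε) ∧ ε₀ ≤ ‖T i z‖ := by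
  classical
  let P : ℕ → Prop := fun s => ∀ ε > 0, ∀ F : Finset (Σ j, ι j), ∃ z : Z, ‖z‖ = 1 ∧
    (∀ p ∈ F, (hx p.1).coeff (T p.1 z) p.2 = 0) ∧ ∀ j : Fin n, (j : ℕ) < s → ‖T j z‖ ≤ ε
  have hP0 : P 0 := fun ε _ F => by
    obtain ⟨z, hz, hF⟩ := exists_norm_eq_one_coeff_eq_zero hx hZ T F
    exact ⟨z, hz, hF, fun j hj => absurd hj (Nat.not_lt_zero _)⟩
  have hPn : ¬ P n := fun h => by
    obtain ⟨z, hz, -, hs⟩ := h (c / 2) (by positivity) ∅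
    obtain ⟨j, hj⟩ := hT z (fun h0 => by simp [h0, norm_zero 𝕜] at hz)
    have := hs j j.2
    rw [hz] at hj
    linarith
  obtain ⟨s, hsn, hPs, hPs'⟩ : ∃ s < n, P s ∧ ¬ P (s + 1) := by
    by_contra! h
    refine hPn (Nat.le_induction (m := 0) (P := fun k _ => k ≤ n → P k) (fun _ => hP0)
      (fun k _ ih hk => h k hk (ih (by omega))) n (Nat.zero_le _) le_rfl)
  simp only [P] at hPs'
  push Not at hPs'
  obtain ⟨ε₀, hε₀, F₀, h₀⟩ := hPs'
  refine ⟨⟨s, hsn⟩, ε₀, hε₀, fun ε hε F => ?_⟩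
  -- Vanishing on `F₀` forces some component of index at most `s` above `ε₀`; smallness below `ε₀`
  -- excludes all but `s` itself.
  obtain ⟨z, hz, hF, hs⟩ := hPs (min ε ε₀) (lt_min hε hε₀) (F ∪ F₀)
  refine ⟨z, hz, fun p hp => hF p (Finset.mem_union_left _ hp),
    fun j hj => (hs j hj).trans (min_le_left _ _), ?_⟩
  obtain ⟨j, hj, hj'⟩ := h₀ z hz fun p hp => hF p (Finset.mem_union_right _ hp)
  have hjs : (j : ℕ) = s := by
    by_contra hne
    have := (hs j (by omega)).trans (min_le_right _ _)
    linarith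
  have : j = ⟨s, hsn⟩ := Fin.ext hjs
  rw [← this]
  exact hj'.le

/-- If the components in `A` and those in `B` both determine the norm of `Z` up to constants, and
the lower estimates of each `X i` beat the upper estimates of all `X j` with `i < j`, then `Z` has
finite dimension. -/
theorem finiteDimensional_of_two_norming_sets (hx : ∀ j, IsUnconditionalBasis 𝕜 (x j))
    (q r : Fin n → ℝ≥0∞) (hq : ∀ i j : Fin n, i < j → 0 < q i)
    (hqr : ∀ i j : Fin n, i < j → q i < r j)
    (hl : ∀ i j : Fin n, i < j → (hx i).LowerEstimate (q i))
    (hu : ∀ i j : Fin n, i < j → (hx j).UpperEstimate (r j))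
    (T : ∀ j, Z →L[𝕜] X j) {A B : Set (Fin n)} (hAB : IsCompl A B) {c : ℝ} (hc : 0 < c)
    (hA : ∀ z : Z, z ≠ 0 → ∃ j ∈ A, c * ‖z‖ ≤ ‖T j z‖)
    (hB : ∀ z : Z, z ≠ 0 → ∃ j ∈ B, c * ‖z‖ ≤ ‖T j z‖) : FiniteDimensional 𝕜 Z := by
  by_contra hZ
  obtain ⟨i, ε₀, hε₀, hi⟩ := exists_critical_index hx hZ T hc
    (fun z hz => (hA z hz).imp fun j hj => hj.2)
  -- The critical index does not refer to the partition, so `A` and `B` may be swapped.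
  wlog hiA : i ∈ A generalizing A B
  · refine this hAB.symm hB hA ?_
    rw [← hAB.compl_eq]
    exact hiA
  have hiB : i ∉ B := fun h => Set.disjoint_left.1 hAB.disjoint hiA h
  obtain ⟨κ, hκ, hadd⟩ := exists_common_norm_add_le 𝕜 X
  have hκ0 : 0 < κ := by linarith
  choose K hK hTK using fun j => exists_norm_map_le (T j)
  -- `η < c` prevents components below `i` from controlling the norm, `η ≤ ε₀ / (2 * κ)` keeps `y i
  -- k` bounded below, and `η ≤ 1` bounds accumulated errors.
  obtain ⟨η, hη, hηc, hηε, hη1⟩ : ∃ η > 0, η < c ∧ η ≤ ε₀ / (2 * κ) ∧ η ≤ 1 :=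
    ⟨min (min (c / 2) (ε₀ / (2 * κ))) 1, by positivity, by
      refine lt_of_le_of_lt ((min_le_left _ _).trans (min_le_left _ _)) (by linarith),
      (min_le_left _ _).trans (min_le_right _ _), min_le_right _ _⟩
  let ε : ℕ → ℝ := fun k => η / (2 * κ) ^ (k + 1)
  have hε : ∀ k, 0 < ε k := fun k => by positivity
  have hεη : ∀ k, ε k ≤ η := fun k =>
    div_le_self hη.le (one_le_pow₀ (by linarith))
  obtain ⟨z, y, hz, hzy, hdis⟩ := exists_gliding_hump hx T ε hε
    (fun k z => ‖z‖ = 1 ∧ (∀ j < i, ‖T j z‖ ≤ ε k) ∧ ε₀ ≤ ‖T i z‖) (fun k F => by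
      obtain ⟨z, h1, h2, h3⟩ := hi (ε k) (hε k) F
      exact ⟨z, h2, h1, h3⟩)
  have hne : ∀ z : Z, ‖z‖ = 1 → z ≠ 0 := fun z hz h0 => by simp [h0, norm_zero 𝕜] at hz
  -- some component above the critical index is present
  obtain ⟨j₀, hij₀⟩ : ∃ j, i < j := by
    obtain ⟨j, hjB, hj⟩ := hB (z 0) (hne _ (hz 0).1)
    refine ⟨j, lt_of_le_of_ne (not_lt.1 fun hji => ?_) fun h => hiB (h ▸ hjB)⟩
    rw [(hz 0).1] at hj
    linarith [(hz 0).2.1 j hji, hεη 0]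
  -- An index above `i` is needed here, since nothing is assumed about `q` at the last index.
  have hq0 := hq i j₀ hij₀
  have hqtop := (hqr i j₀ hij₀).ne_top
  have ht : 0 < 1 / (q i).toReal := one_div_pos.2 (ENNReal.toReal_pos hq0.ne' hqtop)
  set t := 1 / (q i).toReal with ht_def
  let S : ℕ → Z := fun m => ∑ k ∈ Finset.range m, z k
  have herr : ∀ j m, ‖T j (S m) - ∑ k ∈ Finset.range m, y j k‖ ≤ 1 := fun j m => by
    simp only [S]
    rw [map_sum, ← Finset.sum_sub_distrib]
    exact (norm_sum_le_of_norm_le_geometric 𝕜 hκ (hadd j) hη.le _ (hzy j) m).trans hη1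
  have hdis' : ∀ j m, Pairwise fun k l : Fin m =>
      Disjoint ((hx j).supp (y j k)) ((hx j).supp (y j l)) := fun j m k l hkl =>
    hdis j (fun h => hkl (Fin.ext h))
  -- the critical component is large
  have hlarge : ∃ b > 0, ∀ m : ℕ, b * (m : ℝ) ^ t ≤ ‖S m‖ + 1 := by
    obtain ⟨C, hC, hl⟩ := hl i j₀ hij₀
    have hy : ∀ k, ε₀ / (2 * κ) ≤ ‖y i k‖ := fun k => by
      have h1 := hadd i (T i (z k) - y i k) (y i k)
      rw [sub_add_cancel] at h1
      have h2 := (hzy i k).trans ((hεη k).trans hηε)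
      have h3 := (hz k).2.2
      have h4 : κ * (ε₀ / (2 * κ)) = ε₀ / 2 := by field_simp
      have h5 : κ * (ε₀ / (2 * κ)) ≤ κ * ‖y i k‖ := by nlinarith
      exact le_of_mul_le_mul_left h5 hκ0
    refine ⟨ε₀ / (2 * κ) / (C * κ * (K i + 1)), by have := hK i; positivity, fun m => ?_⟩
    have h1 := hl m (fun k => y i k) (hdis' i m)
    rw [Fin.sum_univ_eq_sum_range (fun k => y i k) m] at h1
    have h2 := mul_rpow_le_lqSum hq0 hqtop (a := fun k : Fin m => ‖y i k‖)
      (by positivity : 0 ≤ ε₀ / (2 * κ)) fun k => hy k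
    have h3 := hadd i (∑ k ∈ Finset.range m, y i k - T i (S m)) (T i (S m))
    rw [sub_add_cancel, norm_sub_comm 𝕜] at h3
    have h4 := herr i m
    have h5 := hTK i (S m)
    have h6 := norm_nonneg 𝕜 (S m)
    have hKi := hK i
    rw [div_mul_eq_mul_div, div_le_iff₀ (by positivity)]
    calc _ ≤ _ := h2
      _ ≤ C * ‖∑ k ∈ Finset.range m, y i k‖ := h1
      _ ≤ C * (κ * ((K i + 1) * (‖S m‖ + 1))) := by
        gcongr
        refine h3.trans ?_
        gcongr
        nlinarith
      _ = _ := by ring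
  -- all components in `B` are small
  have hsmall : ∀ j ∈ B, ∀ δ > 0, ∀ᶠ m : ℕ in Filter.atTop, ‖T j (S m)‖ ≤ δ * (m : ℝ) ^ t := by
    intro j hj δ hδ
    rcases lt_trichotomy i j with hij | hij | hij
    · obtain ⟨C, hC, hu⟩ := hu i j hij
      have hy : ∀ k, ‖y j k‖ ≤ κ * (1 + K j) := fun k => by
        have h1 := hadd j (y j k - T j (z k)) (T j (z k))
        rw [sub_add_cancel, norm_sub_comm 𝕜] at h1
        refine h1.trans ?_
        have h2 := hTK j (z k)
        rw [(hz k).1, mul_one] at h2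
        gcongr
        exact (hzy j k).trans ((hεη k).trans hη1)
      have hKj := hK j
      filter_upwards [eventually_affine_rpow_le ht
        (one_div_toReal_lt hq0 (hqr i j hij)) (κ * (C * (κ * (1 + K j)))) κ hδ] with m hm
      refine le_trans ?_ hm
      have h1 := hu m (fun k => y j k) (hdis' j m)
      rw [Fin.sum_univ_eq_sum_range (fun k => y j k) m] at h1
      have h2 := lqSum_le_mul_rpow (hq0.trans (hqr i j hij)) (a := fun k : Fin m => ‖y j k‖)
        (by positivity : 0 ≤ κ * (1 + K j)) (fun k => norm_nonneg 𝕜 _) fun k => hy k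
      have h3 := hadd j (T j (S m) - ∑ k ∈ Finset.range m, y j k) (∑ k ∈ Finset.range m, y j k)
      rw [sub_add_cancel] at h3
      calc _ ≤ _ := h3
        _ ≤ κ * (1 + C * (κ * (1 + K j) * (m : ℝ) ^ (1 / (r j).toReal))) := by
          gcongr
          · exact herr j m
          · exact h1.trans (by gcongr)
        _ = _ := by ring
    · exact absurd (hij ▸ hj) hiB
    · filter_upwards [eventually_affine_rpow_le ht ht 0 1 hδ] with m hm
      refine le_trans ?_ hm
      simp only [S]
      rw [map_sum, zero_mul, zero_add]
      exact (norm_sum_le_of_norm_le_geometric 𝕜 hκ (hadd j) hη.le _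
        (fun k => (hz k).2.1 j hij) m).trans hη1
  obtain ⟨b, hb, hlarge⟩ := hlarge
  have hall : ∀ᶠ m : ℕ in Filter.atTop, ∀ j, j ∈ B → ‖T j (S m)‖ ≤ c * (b / 4) * (m : ℝ) ^ t :=
    Filter.eventually_all.2 fun j => by
      by_cases hj : j ∈ B
      · filter_upwards [hsmall j hj (c * (b / 4)) (by positivity)] with m hm _ using hm
      · exact Filter.Eventually.of_forall fun m h => absurd h hj
  -- With `‖S m‖` and `1` both at most `b / 4 * m ^ t`, the lower bound `b * m ^ t ≤ ‖S m‖ + 1`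
  -- fails.
  obtain ⟨m, ⟨hm, h1⟩, hm0⟩ := ((hall.and (eventually_affine_rpow_le ht ht 0 1
    (by positivity : 0 < b / 4))).and (Filter.eventually_gt_atTop 0)).exists
  have hpos : 0 < b * (m : ℝ) ^ t := by positivity
  have hSm : ‖S m‖ ≤ b / 4 * (m : ℝ) ^ t := by
    by_cases h0 : S m = 0
    · rw [h0, norm_zero 𝕜]; positivity
    · obtain ⟨j, hj, hj'⟩ := hB (S m) h0
      have := hj'.trans (hm j hj)
      rw [mul_assoc] at this
      exact le_of_mul_le_mul_left this hc
  linarith [hlarge m]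

end Embeddings

/-- The spaces `X_1, …, X_n` are indexed by `Fin n`, so `X_j` has index `j - 1`. The direct sum over
a set of indices is the finite product, whose topology is that of the maximum of the quasi-norms. -/
theorem proposition4p7 {𝕜 : Type*} [RCLike 𝕜] {n : ℕ} {X : Fin n → Type u}
    [∀ j, AddCommGroup (X j)] [∀ j, Module 𝕜 (X j)] [∀ j, Norm (X j)] [∀ j, UniformSpace (X j)]
    [∀ j, QuasiBanachSpace 𝕜 (X j)]
    {ι : Fin n → Type v} {x : (j : Fin n) → ι j → X j}
    (hx : ∀ j, IsUnconditionalBasis 𝕜 (x j))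
    (q r : Fin n → ℝ≥0∞)
    (hq_pos : ∀ j : Fin n, (j : ℕ) + 1 < n → 0 < q j)
    (hr_pos : ∀ j : Fin n, 0 < (j : ℕ) → 0 < r j)
    (hqr : ∀ j k : Fin n, (j : ℕ) + 1 = k → q j < r k)
    (h_lower : ∀ j : Fin n, (j : ℕ) + 1 < n → (hx j).LowerEstimate (q j))
    (h_upper : ∀ j : Fin n, 0 < (j : ℕ) → (hx j).UpperEstimate (r j))
    (h_mid : ∀ j : Fin n, 0 < (j : ℕ) → (j : ℕ) + 1 < n →
      ¬ FiniteDimensional 𝕜 (X j) ∨ r j ≤ q j)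
    (A B : Set (Fin n)) (hAB : IsCompl A B) :
    TotallyIncomparable.{w} 𝕜 ((j : A) → X j) ((j : B) → X j) := by
  classical
  have hlt : ∀ i j : Fin n, i < j → (i : ℕ) + 1 < n := fun i j hij => by omega
  have hpos : ∀ i j : Fin n, i < j → 0 < (j : ℕ) := fun i j hij => by omega
  have hrq : ∀ j : Fin n, 0 < (j : ℕ) → (j : ℕ) + 1 < n → r j ≤ q j := fun j h0 h1 =>
    (h_mid j h0 h1).elim (fun hX => (hx j).le_of_lowerEstimate_of_upperEstimate hX
      (hq_pos j h1) (h_lower j h1) (h_upper j h0)) id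
  -- The chain is `q i < r (i + 1) ≤ q (i + 1) < r (i + 2) ≤ ⋯`.
  have hchain : ∀ i : Fin n, ∀ k : ℕ, (i : ℕ) + 1 ≤ k → ∀ hk : k < n, q i < r ⟨k, hk⟩ := by
    intro i k hik
    induction k, hik using Nat.le_induction with
    | base => exact fun hk => hqr i ⟨_, hk⟩ rfl
    | succ k hik ih =>
      intro hk
      have h1 := ih (by omega)
      have h2 := hrq ⟨k, by omega⟩ (by simp only; omega) hk
      exact h1.trans (h2.trans_lt (hqr ⟨k, by omega⟩ ⟨k + 1, hk⟩ rfl))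
  rintro ⟨Z, _, _, _, _, _, hZ, ⟨M, ⟨e⟩⟩, ⟨N, ⟨f⟩⟩⟩
  obtain ⟨c, hc, he⟩ := QuasiBanachSpace.exists_le_norm_component e
  obtain ⟨d, hd, hf⟩ := QuasiBanachSpace.exists_le_norm_component f
  -- Both embeddings are merged into one family, so that the critical index is sought among all `n`
  -- spaces; the value `0` never occurs, as `A` and `B` cover all indices.
  let T : ∀ j, Z →L[𝕜] X j := fun j =>
    if hA : j ∈ A then
      ((ContinuousLinearMap.proj (⟨j, hA⟩ : A)).comp M.subtypeL).comp (e : Z →L[𝕜] M)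
    else if hB : j ∈ B then
      ((ContinuousLinearMap.proj (⟨j, hB⟩ : B)).comp N.subtypeL).comp (f : Z →L[𝕜] N)
    else 0
  have hTA : ∀ (j : A) z, T j z = (e z : (j : A) → X j) j := fun j z => by
    simp [T, j.2]
  have hTB : ∀ (j : B) z, T j z = (f z : (j : B) → X j) j := fun j z => by
    have hj : (j : Fin n) ∉ A := fun h => Set.disjoint_left.1 hAB.disjoint h j.2
    simp [T, j.2, hj]
  refine hZ (finiteDimensional_of_two_norming_sets hx q r (fun i j hij => hq_pos i (hlt i j hij))
    (fun i j hij => hchain i j hij j.2) (fun i j hij => h_lower i (hlt i j hij))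
    (fun i j hij => h_upper j (hpos i j hij)) T hAB (lt_min hc hd) (fun z hz => ?_)
    fun z hz => ?_)
  · obtain ⟨j, hj⟩ := he z hz
    refine ⟨j, j.2, le_trans ?_ (hj.trans_eq (by rw [hTA]))⟩
    exact mul_le_mul_of_nonneg_right (min_le_left _ _) (QuasiBanachSpace.norm_nonneg 𝕜 z)
  · obtain ⟨j, hj⟩ := hf z hz
    refine ⟨j, j.2, le_trans ?_ (hj.trans_eq (by rw [hTB]))⟩
    exact mul_le_mul_of_nonneg_right (min_le_right _ _) (QuasiBanachSpace.norm_nonneg 𝕜 z)
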